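/- We work over $\mathbb{C}$; a variety is an irreducible, reduced, separated scheme of finite type over $\mathrm{Spec}\,\mathbb{C}$. Let $X, Y_1, Y_2$ be normal varieties and let $f_i\colon Y_i\to X$ ($i=1,2$) be projective birational morphisms over $\mathbb{C}$. For $i=1,2$ let $E_i$ be a $\mathbb{Q}$-Cartier $\mathbb{Q}$-divisor on $Y_i$ which is $f_i$-exceptional (every component of $E_i$ has image of codimension at least $2$ in $X$) and such that $-E_i$ is $f_i$-ample. Write $E_i=\sum_F a_{i,F}F$ as a finite sum over prime divisors $F$ of $Y_i$, and let $v_{i,F}(\varphi)=\mathrm{ord}_F(f_i^*\varphi)$ be the valuation of the function field $K(X)$ defined by $F$. Assume that $\sum_F a_{1,F}\,v_{1,F}=\sum_F a_{2,F}\,v_{2,F}$ as formal $\mathbb{Q}$-linear combinations of valuations of $K(X)$. Then $f_1$ and $f_2$ are isomorphic as morphisms over $X$: there is an isomorphism $e\colon Y_1\to Y_2$ with $f_2\circ e=f_1$. -/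

import Mathlib

open CategoryTheory CategoryTheory.Limits AlgebraicGeometry

namespace BirationalGeometry

/-- The base `Spec ℂ`. -/
noncomputable abbrev SpecC : Scheme.{0} := Spec (.of ℂ)

/-- A scheme all of whose local rings are integrally closed. -/
class IsNormalScheme (X : Scheme.{0}) : Prop where
  isIntegrallyClosed_stalk : ∀ x : X, IsIntegrallyClosed (X.presheaf.stalk x)

/-- A normal complex variety: an integral, normal, separated scheme of finite type over `ℂ`. -/
class IsNormalVariety (X : Scheme.{0}) [X.Over SpecC] : Prop extends
    IsIntegral X, IsNormalScheme X where
  isSeparated : IsSeparated (X ↘ SpecC)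
  locallyOfFiniteType : LocallyOfFiniteType (X ↘ SpecC)
  quasiCompact : QuasiCompact (X ↘ SpecC)

instance (X : Scheme.{0}) [X.Over SpecC] [IsNormalVariety X] : IsLocallyNoetherian X :=
  have := IsNormalVariety.locallyOfFiniteType (X := X)
  LocallyOfFiniteType.isLocallyNoetherian (X ↘ SpecC)

section Morphisms

variable {X Y : Scheme.{0}}

/-- `f` is birational: it restricts to an isomorphism from a dense open subscheme of `Y` onto a
dense open subscheme of `X`. -/
class IsBirational (f : Y ⟶ X) : Prop where
  birationalOver : Scheme.BirationalOver f (𝟙 X)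

instance (f : Y ⟶ X) [IsBirational f] : IsDominant f where
  denseRange := by
    obtain ⟨p, hp⟩ := IsBirational.birationalOver (f := f)
    refine p.dense_target.mono ?_
    intro x hx
    refine ⟨p.source.ι (p.iso.inv ⟨x, hx⟩), ?_⟩
    have h : p.iso.inv ≫ p.source.ι ≫ f = p.target.ι := by
      rw [← hp]; simp
    exact congr($h ⟨x, hx⟩)

/-- Projective `n`-space over `ℤ`. -/
noncomputable def projectiveSpaceInt (n : ℕ) : Scheme.{0} :=
  letI := MvPolynomial.gradedAlgebra (σ := Fin (n + 1)) (R := ℤ)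
  Proj (MvPolynomial.homogeneousSubmodule (Fin (n + 1)) ℤ)

/-- Projective `n`-space `ℙⁿ × S` over `S`. -/
noncomputable def projectiveSpace (n : ℕ) (S : Scheme.{0}) : Scheme.{0} :=
  pullback (terminal.from S) (terminal.from (projectiveSpaceInt n))

/-- The projection `ℙⁿ × S ⟶ S`. -/
noncomputable def projectiveSpace.toBase (n : ℕ) (S : Scheme.{0}) : projectiveSpace n S ⟶ S :=
  pullback.fst _ _

/-- `f : Y ⟶ X` is projective: over the members of an open covering of `X` it is a closed
subscheme of a projective space. (This is implied by all the usual global notions of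
projectivity, and agrees with projectivity in the sense of Grothendieck if there is an `f`-ample
divisor and `X` is a variety.) -/
class IsProjective (f : Y ⟶ X) : Prop where
  exists_isClosedImmersion : ∀ x : X, ∃ U : X.Opens, x ∈ U ∧ ∃ (n : ℕ)
    (i : (f ⁻¹ᵁ U).toScheme ⟶ projectiveSpace n U.toScheme),
    IsClosedImmersion i ∧ i ≫ projectiveSpace.toBase n U.toScheme = f ∣_ U

lemma genericPoint_map (f : Y ⟶ X) [IsIntegral X] [IsIntegral Y] [IsDominant f] :
    f (genericPoint Y) = genericPoint X := by
  apply IsGenericPoint.eq _ (genericPoint_spec X)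
  have := (genericPoint_spec Y).image f.continuous
  rwa [Set.image_univ, f.denseRange.closure_range] at this

/-- The inclusion of function fields `K(X) → K(Y)`, `φ ↦ f^*φ`, for a dominant `f : Y ⟶ X`. -/
noncomputable def pullbackFunction (f : Y ⟶ X) [IsIntegral X] [IsIntegral Y] [IsDominant f] :
    X.functionField →+* Y.functionField :=
  (X.presheaf.stalkSpecializes (specializes_of_eq (genericPoint_map f)) ≫
    f.stalkMap (genericPoint Y)).hom

end Morphisms

section Divisors

/-- A prime divisor, represented by its generic point: a point of codimension one. -/
def PrimeDivisor (Y : Scheme.{0}) : Type := {y : Y // Order.coheight y = 1}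

/-- A `ℚ`-divisor: a finite formal `ℚ`-linear combination of prime divisors. -/
abbrev QDivisor (Y : Scheme.{0}) : Type := PrimeDivisor Y →₀ ℚ

lemma isDiscreteValuationRing_stalk (Y : Scheme.{0}) [IsIntegral Y] [IsLocallyNoetherian Y]
    [IsNormalScheme Y] (F : PrimeDivisor Y) : IsDiscreteValuationRing (Y.presheaf.stalk F.1) := by
  have h1 := IsNormalScheme.isIntegrallyClosed_stalk F.1
  have hdim : ringKrullDim (Y.presheaf.stalk F.1) = 1 := by
    rw [ringKrullDim_stalk_eq_coheight, F.2]; rfl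
  have hle : Ring.KrullDimLE 1 (Y.presheaf.stalk F.1) := krullDimLE_of_coheight_le F.2.le
  have hf : ¬ IsField (Y.presheaf.stalk F.1) := fun h => by
    rw [ringKrullDim_eq_zero_of_isField h] at hdim
    exact zero_ne_one hdim
  have h2 : ∃! P : Ideal (Y.presheaf.stalk F.1), P ≠ ⊥ ∧ P.IsPrime := by
    refine ⟨IsLocalRing.maximalIdeal _, ⟨?_, inferInstance⟩, fun P hP => ?_⟩
    · exact fun h => hf (IsLocalRing.isField_iff_maximalIdeal_eq.mpr h)
    · exact IsLocalRing.eq_maximalIdeal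
        (Ring.krullDimLE_one_iff_of_noZeroDivisors.mp hle P hP.1 hP.2)
  have h3 := And.intro h1 h2
  exact ((IsDiscreteValuationRing.TFAE (Y.presheaf.stalk F.1) hf).out 0 3).mpr h3

open Classical in
/-- The order of vanishing along a prime divisor `F` of a normal scheme, as a valuation of the
function field. -/
noncomputable def PrimeDivisor.valuation {Y : Scheme.{0}} [IsIntegral Y] [IsLocallyNoetherian Y]
    [IsNormalScheme Y] (F : PrimeDivisor Y) : AddValuation Y.functionField (WithTop ℤ) :=
  AddValuation.of (fun φ => if φ = 0 then ⊤ else (Scheme.ord φ F.1 : WithTop ℤ))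
    (by simp)
    (by
      have h := Scheme.ord_mul (x := F.1) (one_ne_zero (α := Y.functionField)) one_ne_zero
      rw [one_mul] at h
      have h0 : Scheme.ord (1 : Y.functionField) F.1 = 0 := by omega
      simp [h0])
    (fun φ ψ => by
      have := isDiscreteValuationRing_stalk Y F
      by_cases hs : φ + ψ = 0
      · simp [hs]
      have h := Scheme.ord_add (x := F.1) hs
      by_cases hφ : φ = 0
      · simp [hφ]
      by_cases hψ : ψ = 0
      · simp [hψ]
      simp only [hs, hφ, hψ, if_false]
      exact_mod_cast h)
    (fun φ ψ => by
      by_cases hφ : φ = 0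
      · simp [hφ]
      by_cases hψ : ψ = 0
      · simp [hψ]
      simp [hφ, hψ, Scheme.ord_mul hφ hψ])

variable {X Y : Scheme.{0}}

/-- For `f : Y ⟶ X` dominant, the `ℚ`-linear combination of valuations of `K(X)` defined by a
`ℚ`-divisor `D = ∑ a_F F` on `Y`, namely `∑ a_F v_F` where `v_F(φ) = ord_F(f^*φ)`, as an element
of the free `ℚ`-module on the valuations of `K(X)`. -/
noncomputable def valuationCombination (f : Y ⟶ X) [IsIntegral X] [IsIntegral Y]
    [IsLocallyNoetherian Y] [IsNormalScheme Y] [IsDominant f] (D : QDivisor Y) :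
    AddValuation X.functionField (WithTop ℤ) →₀ ℚ :=
  D.mapDomain fun F => F.valuation.comap (pullbackFunction f)

/-- `D` is `f`-exceptional: the image in `X` of each component of `D` has codimension at least
two. -/
def IsExceptional (f : Y ⟶ X) (D : QDivisor Y) : Prop :=
  ∀ F ∈ D.support, 2 ≤ Order.coheight (f F.1)

variable [IsIntegral Y] [IsLocallyNoetherian Y]

/-- `D` is a Cartier divisor: it is integral and locally principal. -/
def IsCartier (D : QDivisor Y) : Prop :=
  ∀ y : Y, ∃ U : Y.Opens, y ∈ U ∧ ∃ φ : Y.functionField, φ ≠ 0 ∧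
    ∀ F : PrimeDivisor Y, F.1 ∈ U → D F = (Scheme.ord φ F.1 : ℚ)

/-- `D` is `ℚ`-Cartier: some positive multiple of `D` is Cartier. -/
def IsQCartier (D : QDivisor Y) : Prop :=
  ∃ m : ℕ, 0 < m ∧ IsCartier (m • D)

/-- The nonzero rational function `φ` is a section over `U` of `𝒪_Y(D)`:
`div φ + D` is effective on `U`. -/
def IsSection (D : QDivisor Y) (U : Y.Opens) (φ : Y.functionField) : Prop :=
  φ ≠ 0 ∧ ∀ F : PrimeDivisor Y, F.1 ∈ U → 0 ≤ (Scheme.ord φ F.1 : ℚ) + D F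

/-- The locus in `U` where a section `φ` of `𝒪_Y(D)` over `U` does not vanish: the complement of
the support of the divisor `div φ + D`. (If `Y` is normal and `D` is Cartier, these are the points
at which `φ` generates the invertible sheaf `𝒪_Y(D)`.) -/
def nonvanishingLocus (D : QDivisor Y) (U : Y.Opens) (φ : Y.functionField) : Set Y :=
  {y | y ∈ U ∧ ∀ F : PrimeDivisor Y, F.1 ⤳ y → (Scheme.ord φ F.1 : ℚ) + D F = 0}

/-- For a Cartier divisor `D` on a normal scheme: the invertible sheaf `𝒪_Y(D)` is ample on the
open subscheme `U`, that is, every point of `U` lies in an affine nonvanishing locus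
of some section over `U` of some positive power of `𝒪_Y(D)`. -/
def IsAmpleOn (D : QDivisor Y) (U : Y.Opens) : Prop :=
  IsCompact (U : Set Y) ∧
  ∀ y ∈ U, ∃ n : ℕ, 0 < n ∧ ∃ φ : Y.functionField, IsSection (n • D) U φ ∧
    ∃ W : Y.Opens, IsAffineOpen W ∧ y ∈ W ∧ (W : Set Y) = nonvanishingLocus (n • D) U φ

/-- The `ℚ`-Cartier divisor `D` on `Y` is `f`-ample: for some `m > 0` with `m D` Cartier, the
invertible sheaf `𝒪_Y(m D)` is ample over every affine open subscheme of `X`. -/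
def IsRelativelyAmple (f : Y ⟶ X) (D : QDivisor Y) : Prop :=
  ∃ m : ℕ, 0 < m ∧ IsCartier (m • D) ∧
    ∀ V : X.Opens, IsAffineOpen V → IsAmpleOn (m • D) (f ⁻¹ᵁ V)

end Divisors

end BirationalGeometry

open BirationalGeometry

/-! Classically, `Y_i` is the relative Proj of the algebra of sections of multiples of `-E_i`, and
this algebra depends only on the combination of valuations. Indeed, inside `K(X)`, a section of
`𝒪(-N E_i)` over the preimage of an open `V` is a function satisfying one inequality for each prime
divisor over `V`. Divisors with nonzero coefficient, and their inequalities, are common to both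
sides. Since `E_i` is exceptional, the codimension-one points of `V` carry divisors with zero
coefficient, so the function is regular in codimension one on `V`, hence regular on `V` by
normality; the remaining inequalities are then automatic. This is
`IsSection.of_valuationCombination_eq`.

Proj itself is replaced by a comparison of local rings inside `K(X)`. A valuation ring dominating
the local ring at `y₁` has a center `y₂` on `Y₂` by properness (`exists_stalkSubring_le`). Ampleness
gives sections `α₁`, `α₂` of a common multiple, nonvanishing at `y₁` and `y₂` respectively. Then `α₂
/ α₁` is regular at `y₁` and its inverse lies in the valuation ring, so by domination it is a unit
at `y₁`: `α₂` does not vanish at `y₁` either. Functions on the affine locus of `α₂` are sections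
divided by powers of `α₂`, so they are regular at `y₁`, and the local ring at `y₂` is contained in
that at `y₁` (`exists_stalkSubring_le_stalkSubring`). These inclusions extend the birational map to
a morphism over `X` (`exists_hom_of_forall_stalkSubring_le`); exchanging the roles gives its
inverse. -/

/-! ### Normal Noetherian domains and their primes of height one. -/

section CommutativeAlgebra

variable {A K : Type*} [CommRing A] [IsDomain A] [Field K] [Algebra A K] [IsFractionRing A K]

/-- In a Noetherian integrally closed domain, an associated prime of a nonzero principal ideal has
height one. -/
lemma Ideal.height_eq_one_of_forall_mem_iff_dvd_mul [IsNoetherianRing A] [IsIntegrallyClosed A]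
    {b c : A} (hb : b ≠ 0) (P : Ideal A) [P.IsPrime] (hP : ∀ x, x ∈ P ↔ b ∣ x * c) :
    P.height = 1 := by
  have hbP : b ∈ P := (hP b).mpr (dvd_mul_right _ _)
  have hP0 : P ≠ ⊥ := fun h => hb (by simpa [h] using hbP)
  refine le_antisymm ?_ ?_
  -- Multiplication by `c / b` sends `P` into `A`. If some `x ∈ P` leaves `P`, then `P` is minimal
  -- over `(x)` and Krull's theorem applies; otherwise `P` is stable and `c / b` is integral.
  · by_cases h : ∃ x ∈ P, ∃ u, u ∉ P ∧ x * c = b * u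
    · obtain ⟨x, hx, u, hu, hxu⟩ := h
      refine Ideal.height_le_one_of_isPrincipal_of_mem_minimalPrimes (Ideal.span {x}) P
        ⟨⟨inferInstance, by simpa [Ideal.span_le] using hx⟩, fun Q hQ hQP y hy => ?_⟩
      have := hQ.1
      obtain ⟨v, hv⟩ := (hP y).mp hy
      have h1 : y * u = x * v := by
        apply mul_left_cancel₀ hb
        calc b * (y * u) = y * (x * c) := by rw [hxu]; ring
          _ = b * (x * v) := by rw [mul_left_comm, hv]; ring
      have h2 : y * u ∈ Q := h1 ▸ Q.mul_mem_right _ (hQ.2 (Ideal.mem_span_singleton_self x))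
      exact (hQ.1.mem_or_mem h2).resolve_right fun h => hu (hQP h)
    · exfalso
      push Not at h
      let L := FractionRing A
      have hb' : algebraMap A L b ≠ 0 := by simpa using hb
      have hint : IsIntegral A (algebraMap A L c / algebraMap A L b) := by
        refine isIntegral_of_smul_mem_submodule (M := L) (Submodule.map (Algebra.linearMap A L) P)
          ?_ (Submodule.FG.map _ (IsNoetherian.noetherian _)) _ ?_
        · rw [Submodule.ne_bot_iff]
          exact ⟨_, ⟨b, hbP, rfl⟩, hb'⟩
        · rintro _ ⟨x, hx, rfl⟩
          obtain ⟨u, hu⟩ := (hP x).mp hx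
          have huP : u ∈ P := by_contra fun hn => h x hx u hn hu
          refine ⟨u, huP, ?_⟩
          simp only [Algebra.linearMap_apply, smul_eq_mul]
          rw [div_mul_eq_mul_div, eq_div_iff hb', ← map_mul, ← map_mul, mul_comm c x, hu, mul_comm]
      obtain ⟨d, hd⟩ := IsIntegrallyClosed.isIntegral_iff.mp hint
      rw [eq_div_iff hb', ← map_mul] at hd
      have hd' : d * b = c := FaithfulSMul.algebraMap_injective A L hd
      refine (inferInstance : P.IsPrime).ne_top ((Ideal.eq_top_iff_one _).mpr ?_)
      rw [hP, ← hd']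
      simp
  · rw [Order.one_le_iff_pos, pos_iff_ne_zero]
    intro h
    rw [Ideal.height_eq_zero_iff, IsDomain.minimalPrimes_eq_singleton_bot] at h
    exact hP0 h

/-- A Noetherian integrally closed domain is the intersection of its localizations at primes of
height one. -/
lemma IsIntegrallyClosed.mem_range_of_forall_height_eq_one [IsNoetherianRing A]
    [IsIntegrallyClosed A] (g : K)
    (h : ∀ P : Ideal A, P.IsPrime → P.height = 1 →
      ∃ a s : A, s ∉ P ∧ g * algebraMap A K s = algebraMap A K a) :
    g ∈ (algebraMap A K).range := by
  obtain ⟨a, b, hb, rfl⟩ := IsFractionRing.div_surjective (A := A) g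
  have hb0 : b ≠ 0 := nonZeroDivisors.ne_zero hb
  have hb' : algebraMap A K b ≠ 0 := by simpa using hb0
  by_cases hab : b ∣ a
  · obtain ⟨c, rfl⟩ := hab
    exact ⟨c, by rw [map_mul]; field_simp⟩
  exfalso
  -- `P` contains the annihilator of `a` modulo `b`, while a denominator of `a / b` outside `P`
  -- would annihilate `a` modulo `b`.
  obtain ⟨P, hP, hle⟩ := exists_le_isAssociatedPrime_of_isNoetherianRing A
    (Ideal.Quotient.mk (Ideal.span {b}) a)
    (by rwa [Ne, Ideal.Quotient.eq_zero_iff_mem, Ideal.mem_span_singleton])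
  obtain ⟨hPp, c, hc⟩ := isAssociatedPrime_iff.mp hP
  obtain ⟨c, rfl⟩ := Ideal.Quotient.mk_surjective c
  have key : ∀ x c : A, x ∈ (⊥ : Submodule A (A ⧸ Ideal.span {b})).colon
      {Ideal.Quotient.mk (Ideal.span {b}) c} ↔ b ∣ x * c := fun x c => by
    rw [Submodule.mem_colon_singleton, Submodule.mem_bot, Algebra.smul_def,
      Ideal.Quotient.algebraMap_eq, ← map_mul, Ideal.Quotient.eq_zero_iff_mem,
      Ideal.mem_span_singleton]
  obtain ⟨r, s, hs, hrs⟩ := h P hPp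
    (Ideal.height_eq_one_of_forall_mem_iff_dvd_mul hb0 P fun x => by rw [hc, key])
  refine hs (hle ((key _ _).mpr ⟨r, ?_⟩))
  apply FaithfulSMul.algebraMap_injective A K
  rw [map_mul, map_mul, ← hrs]
  field_simp

open Ring in
lemma IsDiscreteValuationRing.one_le_ordFrac_iff [IsDiscreteValuationRing A] {g : K} (hg : g ≠ 0) :
    1 ≤ ordFrac A g ↔ g ∈ (algebraMap A K).range := by
  refine ⟨fun h => ?_, ?_⟩
  · rw [ordFrac_eq_valuation_inv, one_le_inv₀ (by simpa [zero_lt_iff] using hg)] at h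
    exact IsDiscreteValuationRing.exists_lift_of_le_one h
  · rintro ⟨a, rfl⟩
    exact ordFrac_ge_one_of_ne_zero (by simpa using hg)

end CommutativeAlgebra

namespace BirationalGeometry

/-! ### Regularity and poles of rational functions. -/

section Regular

variable {Y : Scheme.{0}} [IsIntegral Y]

/-- The rational function `g` lies in the local ring of `Y` at `y`. -/
def IsRegularAt (g : Y.functionField) (y : Y) : Prop :=
  g ∈ (algebraMap (Y.presheaf.stalk y) Y.functionField).range

lemma algebraMap_stalk_eq (y : Y) : algebraMap (Y.presheaf.stalk y) Y.functionField =
    (Y.presheaf.stalkSpecializes (genericPoint_specializes y)).hom := rfl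

lemma algebraMap_stalkSpecializes {x y : Y} (h : x ⤳ y) (a : Y.presheaf.stalk y) :
    algebraMap (Y.presheaf.stalk x) Y.functionField (Y.presheaf.stalkSpecializes h a) =
      algebraMap (Y.presheaf.stalk y) Y.functionField a := by
  rw [algebraMap_stalk_eq, algebraMap_stalk_eq, ← CommRingCat.comp_apply,
    TopCat.Presheaf.stalkSpecializes_comp]

lemma IsRegularAt.of_specializes {g : Y.functionField} {x y : Y} (hg : IsRegularAt g y)
    (h : x ⤳ y) : IsRegularAt g x := by
  obtain ⟨a, rfl⟩ := hg
  exact ⟨_, algebraMap_stalkSpecializes h a⟩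

variable {W : Y.Opens} (hW : IsAffineOpen W)

include hW in
lemma isRegularAt_iff_of_isAffineOpen [Nonempty W] (y : W) (g : Y.functionField) :
    IsRegularAt g y ↔ ∃ a s : Γ(Y, W), s ∉ (hW.primeIdealOf y).asIdeal ∧
      g * Y.germToFunctionField W s = Y.germToFunctionField W a := by
  have hloc := hW.isLocalization_stalk y
  let _ := Y.presheaf.algebra_section_stalk y
  have htower := functionField_isScalarTower Y W y
  constructor
  · rintro ⟨b, rfl⟩
    obtain ⟨⟨a, s⟩, h⟩ := IsLocalization.surj (hW.primeIdealOf y).asIdeal.primeCompl b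
    refine ⟨a, s, s.2, ?_⟩
    have := congr(algebraMap _ Y.functionField $h)
    rw [map_mul, ← IsScalarTower.algebraMap_apply, ← IsScalarTower.algebraMap_apply] at this
    exact this
  · rintro ⟨a, s, hs, h⟩
    have hu := IsLocalization.map_units (Y.presheaf.stalk y.1)
      (⟨s, hs⟩ : (hW.primeIdealOf y).asIdeal.primeCompl)
    refine ⟨IsLocalization.mk' _ a (⟨s, hs⟩ : (hW.primeIdealOf y).asIdeal.primeCompl), ?_⟩
    have h2 := congr(algebraMap _ Y.functionField $(IsLocalization.mk'_spec (Y.presheaf.stalk y.1) a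
      (⟨s, hs⟩ : (hW.primeIdealOf y).asIdeal.primeCompl)))
    rw [map_mul, ← IsScalarTower.algebraMap_apply, ← IsScalarTower.algebraMap_apply] at h2
    have h3 := (hu.map (algebraMap _ Y.functionField)).ne_zero
    rw [← IsScalarTower.algebraMap_apply] at h3
    exact mul_right_cancel₀ h3 (h2.trans h.symm)

omit [IsIntegral Y] in
lemma height_primeIdealOf (y : W) :
    ((hW.primeIdealOf y).asIdeal.height : WithBot ℕ∞) = Order.coheight y.1 := by
  have hloc := hW.isLocalization_stalk y
  let _ := Y.presheaf.algebra_section_stalk y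
  rw [← ringKrullDim_stalk_eq_coheight, IsLocalization.AtPrime.ringKrullDim_eq_height
    (hW.primeIdealOf y).asIdeal (Y.presheaf.stalk y.1)]

omit [IsIntegral Y] in
lemma primeIdealOf_fromSpec (p : PrimeSpectrum Γ(Y, W)) (h : hW.fromSpec p ∈ W) :
    hW.primeIdealOf ⟨hW.fromSpec p, h⟩ = p :=
  hW.fromSpec.isOpenEmbedding.injective (hW.fromSpec_primeIdealOf _)

/-- Primes of height one of the local ring at `y` come from prime divisors through `y`. -/
lemma exists_primeDivisor_of_height_eq_one {y : Y} (P : Ideal (Y.presheaf.stalk y)) [P.IsPrime]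
    (hP : P.height = 1) : ∃ F : PrimeDivisor Y, F.1 ⤳ y ∧ ∀ g, IsRegularAt g F.1 →
      ∃ a s : Y.presheaf.stalk y, s ∉ P ∧
        g * algebraMap _ Y.functionField s = algebraMap _ Y.functionField a := by
  obtain ⟨_, ⟨W, hW, rfl⟩, hyW, -⟩ :=
    Y.isBasis_affineOpens.exists_subset_of_mem_open (Set.mem_univ y) isOpen_univ
  have hW : IsAffineOpen W := hW
  have : Nonempty W := ⟨⟨y, hyW⟩⟩
  have hloc := hW.isLocalization_stalk ⟨y, hyW⟩
  let _ := Y.presheaf.algebra_section_stalk (U := W) ⟨y, hyW⟩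
  have htower := functionField_isScalarTower Y W ⟨y, hyW⟩
  let q : PrimeSpectrum Γ(Y, W) := ⟨P.under Γ(Y, W), inferInstance⟩
  have hq : q.asIdeal.height = 1 := by
    rw [← hP]
    exact IsLocalization.height_under (hW.primeIdealOf ⟨y, hyW⟩).asIdeal.primeCompl P
  have hqW : hW.fromSpec q ∈ W := by
    have : hW.fromSpec q ∈ Set.range hW.fromSpec := ⟨q, rfl⟩
    rwa [hW.range_fromSpec] at this
  refine ⟨⟨hW.fromSpec q, ?_⟩, ?_, ?_⟩
  · have := height_primeIdealOf hW ⟨_, hqW⟩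
    rw [primeIdealOf_fromSpec, hq] at this
    exact_mod_cast this.symm
  · have h : q ⤳ hW.primeIdealOf ⟨y, hyW⟩ := by
      rw [← PrimeSpectrum.le_iff_specializes]
      exact ((IsLocalization.AtPrime.orderIsoOfPrime (Y.presheaf.stalk y)
        (hW.primeIdealOf ⟨y, hyW⟩).asIdeal) ⟨P, inferInstance⟩).2.2
    have := h.map hW.fromSpec.continuous
    rwa [hW.fromSpec_primeIdealOf] at this
  · intro g hg
    obtain ⟨a, s, hs, h⟩ := (isRegularAt_iff_of_isAffineOpen hW ⟨_, hqW⟩ g).mp hg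
    rw [primeIdealOf_fromSpec] at hs
    refine ⟨algebraMap _ _ a, algebraMap _ _ s, hs, ?_⟩
    rw [← IsScalarTower.algebraMap_apply, ← IsScalarTower.algebraMap_apply]
    exact h

variable [IsLocallyNoetherian Y]

/-- A rational function on a normal scheme which is regular in codimension one is regular. -/
lemma isRegularAt_of_forall_primeDivisor [IsNormalScheme Y] {y : Y} {g : Y.functionField}
    (h : ∀ F : PrimeDivisor Y, F.1 ⤳ y → IsRegularAt g F.1) : IsRegularAt g y := by
  have := IsNormalScheme.isIntegrallyClosed_stalk y
  refine IsIntegrallyClosed.mem_range_of_forall_height_eq_one g fun P hP hP1 => ?_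
  obtain ⟨F, hF, hF'⟩ := exists_primeDivisor_of_height_eq_one P hP1
  exact hF' g (h F hF)

lemma PrimeDivisor.ord_nonneg_iff [IsNormalScheme Y] (F : PrimeDivisor Y) {g : Y.functionField}
    (hg : g ≠ 0) : 0 ≤ Scheme.ord g F.1 ↔ IsRegularAt g F.1 := by
  have := isDiscreteValuationRing_stalk Y F
  rw [Scheme.le_ord_iff F.2 hg]
  exact IsDiscreteValuationRing.one_le_ordFrac_iff hg

lemma ord_one (y : Y) : Scheme.ord (1 : Y.functionField) y = 0 := by
  have h := Scheme.ord_mul (x := y) (one_ne_zero (α := Y.functionField)) one_ne_zero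
  rw [one_mul] at h
  omega

lemma ord_pow {g : Y.functionField} (hg : g ≠ 0) (n : ℕ) (y : Y) :
    Scheme.ord (g ^ n) y = n * Scheme.ord g y := by
  induction n with
  | zero => simp [ord_one]
  | succ n ih =>
    rw [pow_succ, Scheme.ord_mul (pow_ne_zero _ hg) hg, ih]
    push_cast; ring

lemma ord_inv {g : Y.functionField} (hg : g ≠ 0) (y : Y) :
    Scheme.ord g⁻¹ y = - Scheme.ord g y := by
  have h := Scheme.ord_mul (x := y) hg (inv_ne_zero hg)
  rw [mul_inv_cancel₀ hg, ord_one] at h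
  omega

lemma ord_div {g h : Y.functionField} (hg : g ≠ 0) (hh : h ≠ 0) (y : Y) :
    Scheme.ord (g / h) y = Scheme.ord g y - Scheme.ord h y := by
  rw [div_eq_mul_inv, Scheme.ord_mul hg (inv_ne_zero hh), ord_inv hh]
  ring

include hW in
/-- A rational function has finitely many poles on an affine open. -/
lemma finite_not_isRegularAt (g : Y.functionField) :
    {F : PrimeDivisor Y | F.1 ∈ W ∧ ¬ IsRegularAt g F.1}.Finite := by
  classical
  by_cases hne : Nonempty W
  swap
  · convert Set.finite_empty
    ext F
    simp only [Set.mem_ofPred_eq, Set.mem_empty_iff_false, iff_false]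
    exact fun h => hne ⟨⟨_, h.1⟩⟩
  have := functionField_isFractionRing_of_isAffineOpen Y W hW
  have : IsNoetherianRing Γ(Y, W) := IsLocallyNoetherian.component_noetherian ⟨W, hW⟩
  obtain ⟨a, b, hb, hab⟩ := IsFractionRing.div_surjective (A := Γ(Y, W)) g
  have hb0 : b ≠ 0 := nonZeroDivisors.ne_zero hb
  have hb' : algebraMap Γ(Y, W) Y.functionField b ≠ 0 := by simpa using hb0
  have hfin := (Ideal.finite_minimalPrimes_of_isNoetherianRing _ (Ideal.span {b}))
  -- For `g = a / b`, the prime of a pole contains `b` and has height one, so it is one of the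
  -- finitely many minimal primes over `(b)`.
  refine Set.Finite.of_injOn (f := fun F : PrimeDivisor Y =>
    (if h : F.1 ∈ W then (hW.primeIdealOf ⟨F.1, h⟩).asIdeal else ⊥ : Ideal Γ(Y, W))) ?_ ?_ hfin
  · rintro F ⟨hF, hreg⟩
    simp only [hF, dif_pos]
    have hbF : b ∈ (hW.primeIdealOf ⟨F.1, hF⟩).asIdeal := by
      by_contra hn
      refine hreg ((isRegularAt_iff_of_isAffineOpen hW ⟨F.1, hF⟩ g).mpr ⟨a, b, hn, ?_⟩)
      rw [← hab]
      exact div_mul_cancel₀ _ hb'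
    have hht := height_primeIdealOf hW ⟨F.1, hF⟩
    rw [F.2] at hht
    have hht' : (hW.primeIdealOf ⟨F.1, hF⟩).asIdeal.height = 1 := by exact_mod_cast hht
    refine Ideal.mem_minimalPrimes_of_height_le (by simpa [Ideal.span_le] using hbF) ?_
    have hu : ¬ IsUnit b := fun hu =>
      (hW.primeIdealOf ⟨F.1, hF⟩).isPrime.ne_top (Ideal.eq_top_of_isUnit_mem _ hbF hu)
    rw [hht', Ideal.height_span_singleton_eq_one_of_mem_nonZeroDivisors hb hu]
  · rintro F ⟨hF, -⟩ G ⟨hG, -⟩ h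
    simp only [hF, hG, dif_pos] at h
    apply Subtype.ext
    have h1 := hW.fromSpec_primeIdealOf ⟨F.1, hF⟩
    rw [PrimeSpectrum.ext h, hW.fromSpec_primeIdealOf] at h1
    exact h1.symm

/-- The orders of the poles of a rational function on a quasi-compact open are bounded. -/
lemma exists_forall_neg_le_ord [IsNormalScheme Y] {U : Y.Opens} (hU : IsCompact (U : Set Y))
    {g : Y.functionField} (hg : g ≠ 0) :
    ∃ k : ℕ, ∀ F : PrimeDivisor Y, F.1 ∈ U → -(k : ℤ) ≤ Scheme.ord g F.1 := by
  have key : ∀ W : Y.affineOpens, ∃ k : ℕ, ∀ F : PrimeDivisor Y, F.1 ∈ W.1 →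
      -(k : ℤ) ≤ Scheme.ord g F.1 := fun W => by
    obtain ⟨m, hm⟩ := ((finite_not_isRegularAt W.2 g).image
      fun F => Scheme.ord g F.1).bddBelow
    refine ⟨m.natAbs, fun F hF => ?_⟩
    by_cases h : IsRegularAt g F.1
    · have := (F.ord_nonneg_iff hg).mpr h
      omega
    · have := hm ⟨F, ⟨hF, h⟩, rfl⟩
      simp only at this
      omega
  choose k hk using key
  obtain ⟨t, ht⟩ := hU.elim_finite_subcover (fun W : Y.affineOpens => (W.1 : Set Y))
    (fun W => W.1.2) (fun y _ => by
      obtain ⟨_, ⟨W, hW, rfl⟩, hyW, -⟩ :=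
        Y.isBasis_affineOpens.exists_subset_of_mem_open (Set.mem_univ y) isOpen_univ
      exact Set.mem_iUnion.mpr ⟨⟨W, hW⟩, hyW⟩)
  refine ⟨t.sup k, fun F hF => ?_⟩
  obtain ⟨W, hWt, hFW⟩ := Set.mem_iUnion₂.mp (ht hF)
  have := hk W F hFW
  have h2 : k W ≤ t.sup k := Finset.le_sup hWt
  omega

end Regular

/-! ### Domination, centers of valuation rings, and extension of rational maps. -/

section Centers

open IsLocalRing

/-- The order on `LocalSubring` is domination. This lemma and the next translate it into the
existence of a local homomorphism. -/
lemma LocalSubring.range_le_of_comp_eq {A L : Type*} [CommRing A] [IsLocalRing A] [Field L]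
    {R : LocalSubring L} (g : A →+* L) (f : A →+* R.toSubring) [IsLocalHom f]
    (h : R.toSubring.subtype.comp f = g) : LocalSubring.range g ≤ R := by
  subst h
  refine ⟨?_, ⟨?_⟩⟩
  · rintro _ ⟨a, rfl⟩
    exact (f a).2
  · rintro ⟨_, a, rfl⟩ ha
    have ha' : IsUnit (f a) := ha
    exact (isUnit_of_map_unit f a ha').map (R.toSubring.subtype.comp f).rangeRestrict

lemma LocalSubring.exists_isLocalHom_of_range_le {A L : Type*} [CommRing A] [IsLocalRing A]
    [Field L] {R : LocalSubring L} {g : A →+* L} (h : LocalSubring.range g ≤ R) :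
    ∃ f : A →+* R.toSubring, IsLocalHom f ∧ R.toSubring.subtype.comp f = g := by
  obtain ⟨h1, h2⟩ := h
  refine ⟨(Subring.inclusion h1).comp g.rangeRestrict, ?_, rfl⟩
  have : IsLocalHom g.rangeRestrict := .of_surjective _ g.rangeRestrict_surjective
  exact @RingHom.isLocalHom_comp _ _ _ _ _ _ _ _ h2 this

/-- Morphisms to a separated scheme from the spectrum of a reduced ring are determined on the
spectrum of any larger ring. -/
lemma ext_of_SpecMap_comp_eq {R S : CommRingCat.{0}} [IsReduced R] (f : R ⟶ S)
    (hf : Function.Injective f.hom) {Z : Scheme.{0}} [Z.IsSeparated] {a b : Spec R ⟶ Z}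
    (h : Spec.map f ≫ a = Spec.map f ≫ b) : a = b := by
  have : DenseRange (PrimeSpectrum.comap f.hom) := by
    rw [PrimeSpectrum.denseRange_comap_iff_ker_le_nilRadical,
      (RingHom.injective_iff_ker_eq_bot _).mp hf]
    exact bot_le
  have : IsDominant (Spec.map f) := ⟨this⟩
  exact ext_of_isDominant (Spec.map f) h

variable {L : Type} [Field L] {X Y : Scheme.{0}} [IsIntegral X] [IsIntegral Y]

/-- The image in `L` of the local ring of `Y` at `y`, for a field extension `L` of the function
field of `Y`. -/
noncomputable def stalkSubring (i : Y.functionField →+* L) (y : Y) : LocalSubring L :=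
  LocalSubring.range (i.comp (algebraMap (Y.presheaf.stalk y) Y.functionField))

lemma mem_stalkSubring {i : Y.functionField →+* L} {y : Y} {g : Y.functionField} :
    i g ∈ (stalkSubring i y).toSubring ↔ IsRegularAt g y := by
  constructor
  · rintro ⟨a, ha⟩
    exact ⟨a, i.injective ha⟩
  · rintro ⟨a, rfl⟩
    exact ⟨a, rfl⟩

/-- The morphism from the spectrum of a field extension of the function field onto the generic
point. -/
noncomputable def fromSpecField (i : Y.functionField →+* L) : Spec (.of L) ⟶ Y :=
  Spec.map (CommRingCat.ofHom i) ≫ Y.fromSpecStalk (genericPoint Y)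

lemma fromSpecField_eq (i : Y.functionField →+* L) (y : Y) : fromSpecField i =
    Spec.map (CommRingCat.ofHom (i.comp (algebraMap (Y.presheaf.stalk y) Y.functionField))) ≫
      Y.fromSpecStalk y := by
  rw [fromSpecField, CommRingCat.ofHom_comp, Spec.map_comp, Category.assoc]
  congr 1
  exact (Scheme.SpecMap_stalkSpecializes_fromSpecStalk (genericPoint_specializes y)).symm

lemma fromSpecField_comp (f : Y ⟶ X) [IsDominant f] (i : Y.functionField →+* L) :
    fromSpecField i ≫ f = fromSpecField (i.comp (pullbackFunction f)) := by
  rw [fromSpecField, fromSpecField, Category.assoc, ← Scheme.SpecMap_stalkMap_fromSpecStalk,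
    CommRingCat.ofHom_comp, Spec.map_comp, Category.assoc]
  congr 1
  rw [pullbackFunction, CommRingCat.ofHom_hom, Spec.map_comp, Category.assoc,
    Scheme.SpecMap_stalkSpecializes_fromSpecStalk]

/-- A local subring `R` of `L` dominates the local ring at `y` if and only if `Spec L ⟶ Y` extends
to `Spec R` with the closed point mapping to `y`. -/
lemma stalkSubring_le_iff (i : Y.functionField →+* L) (y : Y) (R : LocalSubring L) :
    stalkSubring i y ≤ R ↔ ∃ m : Spec (.of R.toSubring) ⟶ Y, m (closedPoint R.toSubring) = y ∧
      Spec.map (CommRingCat.ofHom R.toSubring.subtype) ≫ m = fromSpecField i := by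
  constructor
  · intro h
    obtain ⟨ψ, hψ, hψ'⟩ := LocalSubring.exists_isLocalHom_of_range_le h
    refine ⟨Spec.map (CommRingCat.ofHom ψ) ≫ Y.fromSpecStalk y, ?_, ?_⟩
    · have : IsLocalHom (CommRingCat.ofHom ψ).hom := hψ
      exact ((Scheme.Hom.comp_apply ..).trans
        (congrArg _ (Spec_closedPoint (f := CommRingCat.ofHom ψ)))).trans Scheme.fromSpecStalk_closedPoint
    · rw [fromSpecField_eq i y, ← hψ', CommRingCat.ofHom_comp, Spec.map_comp, Category.assoc]
  · rintro ⟨m, rfl, hm⟩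
    have : IsLocalRing (CommRingCat.of R.toSubring) := R.isLocalRing
    let ψ := Scheme.stalkClosedPointTo m
    have hψ : Spec.map ψ ≫ Y.fromSpecStalk _ = m := Scheme.Spec_stalkClosedPointTo_fromSpecStalk m
    refine @LocalSubring.range_le_of_comp_eq _ _ _ _ _ R _ ψ.hom
      (Scheme.isLocalHom_stalkClosedPointTo m) ?_
    replace hm : Spec.map (CommRingCat.ofHom R.toSubring.subtype) ≫ Spec.map ψ ≫
        Y.fromSpecStalk _ = fromSpecField i := by rw [hψ]; exact hm
    rw [fromSpecField_eq i (m (closedPoint R.toSubring)), ← Category.assoc, ← Spec.map_comp] at hm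
    -- `Y.fromSpecStalk` is a monomorphism, so equality after mapping to `Y` descends to the ring
    -- maps.
    have h2 := Spec.map_injective ((cancel_mono (Y.fromSpecStalk _)).mp hm)
    exact congr(($h2).hom)

/-- A local ring dominates at most one local ring of a separated scheme. -/
lemma eq_of_stalkSubring_le [Y.IsSeparated] {i : Y.functionField →+* L} {y y' : Y}
    {R : LocalSubring L} (h : stalkSubring i y ≤ R) (h' : stalkSubring i y' ≤ R) : y = y' := by
  obtain ⟨m, rfl, hm⟩ := (stalkSubring_le_iff i y R).mp h
  obtain ⟨m', rfl, hm'⟩ := (stalkSubring_le_iff i y' R).mp h'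
  rw [ext_of_SpecMap_comp_eq (CommRingCat.ofHom R.toSubring.subtype) Subtype.val_injective
    (hm.trans hm'.symm)]

lemma stalkSubring_comp_pullbackFunction_le (f : Y ⟶ X) [IsDominant f]
    (i : Y.functionField →+* L) (y : Y) :
    stalkSubring (i.comp (pullbackFunction f)) (f y) ≤ stalkSubring i y := by
  obtain ⟨m, hm, hm'⟩ := (stalkSubring_le_iff i y _).mp le_rfl
  refine (stalkSubring_le_iff _ _ _).mpr ⟨m ≫ f, ?_, ?_⟩
  · exact (Scheme.Hom.comp_apply ..).trans (congrArg f hm)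
  · rw [← Category.assoc, hm', fromSpecField_comp]

/-- A valuation ring with a center on `X` has a center on every scheme proper over `X`. -/
lemma exists_stalkSubring_le (f : Y ⟶ X) [IsDominant f] [UniversallyClosed f]
    (i : Y.functionField →+* L) (x : X) (R : ValuationSubring L)
    (h : stalkSubring (i.comp (pullbackFunction f)) x ≤ R.toLocalSubring) :
    ∃ y : Y, f y = x ∧ stalkSubring i y ≤ R.toLocalSubring := by
  obtain ⟨m, hm, hm'⟩ := (stalkSubring_le_iff _ x _).mp h
  have hex : ValuativeCriterion.Existence f := by
    have : (ValuativeCriterion.Existence ⊓ @QuasiCompact) f := by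
      rw [← UniversallyClosed.eq_valuativeCriterion]; infer_instance
    exact this.1
  let S : ValuativeCommSq f :=
    { R := R.toLocalSubring.toSubring
      domain := inferInstance
      valuationRing := inferInstanceAs (ValuationRing R)
      K := L
      isFractionRing := inferInstanceAs (IsFractionRing R L)
      i₁ := fromSpecField i
      i₂ := m
      commSq := ⟨by rw [fromSpecField_comp]; exact hm'.symm⟩ }
  obtain ⟨l, hl1, hl2⟩ := (hex S).exists_lift
  refine ⟨l (closedPoint R.toLocalSubring.toSubring), ?_,
    (stalkSubring_le_iff _ _ _).mpr ⟨l, rfl, hl1⟩⟩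
  exact ((Scheme.Hom.comp_apply ..).symm.trans (congrArg (fun g : Spec _ ⟶ X => g _) hl2)).trans hm

omit [IsIntegral X] in
lemma PartialMap.fromFunctionField_eq (r : Y.PartialMap X) {y : Y} (hy : y ∈ r.domain) :
    r.fromFunctionField = Spec.map (CommRingCat.ofHom
      (algebraMap (Y.presheaf.stalk y) Y.functionField)) ≫ r.fromSpecStalkOfMem hy := by
  rw [Scheme.PartialMap.fromFunctionField, Scheme.PartialMap.fromSpecStalkOfMem,
    Scheme.PartialMap.fromSpecStalkOfMem, ← Category.assoc]
  congr 1
  rw [← cancel_mono r.domain.ι, Category.assoc, Scheme.Opens.fromSpecStalkOfMem_ι,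
    Scheme.Opens.fromSpecStalkOfMem_ι]
  exact (Scheme.SpecMap_stalkSpecializes_fromSpecStalk (genericPoint_specializes y)).symm

omit [IsIntegral X] in
/-- A morphism from the generic point of `Y` which extends to the spectra of all local rings of `Y`
extends to `Y`. -/
lemma exists_hom_of_forall_stalk {S : Scheme.{0}} (sY : Y ⟶ S) (sX : X ⟶ S) [S.IsSeparated]
    [X.IsSeparated] [LocallyOfFiniteType sX] (j : Spec Y.functionField ⟶ X)
    (hj : j ≫ sX = Y.fromSpecStalk (genericPoint Y) ≫ sY)
    (h : ∀ y : Y, ∃ m : Spec (Y.presheaf.stalk y) ⟶ X,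
      Spec.map (CommRingCat.ofHom (algebraMap (Y.presheaf.stalk y) Y.functionField)) ≫ m = j) :
    ∃ e : Y ⟶ X, Y.fromSpecStalk (genericPoint Y) ≫ e = j := by
  let r := Scheme.RationalMap.ofFunctionField sY sX j hj
  have hr : r.fromFunctionField = j := Scheme.RationalMap.fromFunctionField_ofFunctionField ..
  have hdom : r.domain = ⊤ := by
    rw [eq_top_iff]
    intro y _
    obtain ⟨m, hm⟩ := h y
    have hm' : m ≫ sX = Y.fromSpecStalk y ≫ sY := by
      refine ext_of_SpecMap_comp_eq
        (CommRingCat.ofHom (algebraMap (Y.presheaf.stalk y) Y.functionField))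
        (IsFractionRing.injective (Y.presheaf.stalk y) Y.functionField) ?_
      rw [← Category.assoc, hm, hj, ← Category.assoc]
      congr 1
      exact (Scheme.SpecMap_stalkSpecializes_fromSpecStalk (genericPoint_specializes y)).symm
    -- Finite type spreads `m` out to a neighbourhood of `y`; the result represents `r` because both
    -- agree at the generic point.
    let p := Scheme.PartialMap.ofFromSpecStalk sY sX m hm'
    have hp : y ∈ p.domain := Scheme.PartialMap.mem_domain_ofFromSpecStalk ..
    refine Scheme.RationalMap.mem_domain.mpr ⟨p, hp, ?_⟩
    refine Scheme.RationalMap.eq_of_fromFunctionField_eq _ _ ?_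
    rw [hr, Scheme.RationalMap.fromFunctionField_toRationalMap, PartialMap.fromFunctionField_eq p hp,
      Scheme.PartialMap.fromSpecStalkOfMem_ofFromSpecStalk, hm]
  obtain ⟨p, hp, hpj⟩ : ∃ p : Y.PartialMap X, p.domain = ⊤ ∧ p.fromFunctionField = j :=
    ⟨r.toPartialMap, hdom, by
      rw [← Scheme.RationalMap.fromFunctionField_toRationalMap,
        Scheme.RationalMap.toRationalMap_toPartialMap, hr]⟩
  obtain ⟨D, hD, p⟩ := p
  obtain rfl : D = ⊤ := hp
  refine ⟨Y.topIso.inv ≫ p, ?_⟩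
  rw [← hpj, Scheme.PartialMap.fromFunctionField, Scheme.PartialMap.fromSpecStalkOfMem,
    ← Category.assoc]
  congr 1
  rw [← cancel_mono (Scheme.Opens.ι ⊤), Category.assoc, Scheme.Opens.fromSpecStalkOfMem_ι]
  rw [← Scheme.topIso_hom, Iso.inv_hom_id, Category.comp_id]

end Centers

/-! ### Projective morphisms are universally closed. -/

section Projective

-- `Proj` is universally closed over the spectrum of the degree-zero part, and that part is a
-- quotient of `ℤ`, so its spectrum is closed in the terminal scheme.
attribute [local instance] MvPolynomial.gradedAlgebra in
instance universallyClosed_terminal_projectiveSpaceInt (n : ℕ) :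
    UniversallyClosed (terminal.from (projectiveSpaceInt n)) := by
  let 𝒜 := MvPolynomial.homogeneousSubmodule (Fin (n + 1)) ℤ
  have : Algebra.FiniteType (𝒜 0) (MvPolynomial (Fin (n + 1)) ℤ) := by
    rw [← RingHom.finiteType_algebraMap]
    refine RingHom.FiniteType.of_comp_finiteType (f := Int.castRingHom (𝒜 0)) ?_
    rw [Subsingleton.elim (RingHom.comp _ _) (algebraMap ℤ (MvPolynomial (Fin (n + 1)) ℤ)),
      RingHom.finiteType_algebraMap]
    infer_instance
  have h1 : UniversallyClosed (Proj.toSpecZero 𝒜) := inferInstance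
  have hsurj : Function.Surjective (Int.castRingHom (𝒜 0)) := by
    rintro ⟨p, hp⟩
    obtain ⟨r, rfl⟩ := Submodule.mem_one.mp
      ((MvPolynomial.homogeneousSubmodule_zero (σ := Fin (n + 1)) (R := ℤ)).le hp)
    exact ⟨r, Subtype.ext (map_intCast (algebraMap (𝒜 0) (MvPolynomial (Fin (n + 1)) ℤ)) r)⟩
  have h2 : IsClosedImmersion (Spec.map (CommRingCat.ofHom (Int.castRingHom (𝒜 0)))) :=
    IsClosedImmersion.spec_of_surjective _ hsurj
  have h3 : IsIso (terminal.from (Spec (.of ℤ))) :=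
    isIso_of_isTerminal specZIsTerminal terminalIsTerminal _
  have h4 : terminal.from (projectiveSpaceInt n) = Proj.toSpecZero 𝒜 ≫
      Spec.map (CommRingCat.ofHom (Int.castRingHom (𝒜 0))) ≫ terminal.from (Spec (.of ℤ)) :=
    terminal.hom_ext _ _
  rw [h4]
  exact MorphismProperty.comp_mem @UniversallyClosed _ _ h1 inferInstance

instance (n : ℕ) (S : Scheme.{0}) : UniversallyClosed (projectiveSpace.toBase n S) :=
  inferInstanceAs (UniversallyClosed (pullback.fst _ _))

lemma IsProjective.universallyClosed {X Y : Scheme.{0}} (f : Y ⟶ X) [IsProjective f] :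
    UniversallyClosed f := by
  choose U hxU n i hi hif using IsProjective.exists_isClosedImmersion (f := f)
  rw [IsZariskiLocalAtTarget.iff_of_iSup_eq_top (P := @UniversallyClosed) U
    (eq_top_iff.mpr fun x _ => TopologicalSpace.Opens.mem_iSup.mpr ⟨x, hxU x⟩)]
  intro x
  rw [← hif x]
  have := hi x
  infer_instance

end Projective

/-! ### Function fields under birational morphisms. -/

section Birational

variable {X Y : Scheme.{0}} [IsIntegral X] [IsIntegral Y]

/-- Over a dense open subset of `X`, `f` has a section `s` that is an open immersion. The stalk maps
of `s` and of `s ≫ f` at the generic point are isomorphisms, hence so is that of `f`. -/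
lemma pullbackFunction_bijective (f : Y ⟶ X) [IsBirational f] :
    Function.Bijective (pullbackFunction f) := by
  obtain ⟨p, hp⟩ := IsBirational.birationalOver (f := f)
  have : Nonempty p.target := p.dense_target.nonempty.to_subtype
  let s : p.target.toScheme ⟶ Y := p.iso.inv ≫ p.source.ι
  have hs : s ≫ f = p.target.ι := by
    rw [Category.assoc, ← hp]; simp
  have hgen : s (genericPoint p.target) = genericPoint Y := genericPoint_eq_of_isOpenImmersion s
  have h1 : IsIso (f.stalkMap (s (genericPoint p.target))) := by
    have h2 : IsIso ((s ≫ f).stalkMap (genericPoint p.target)) := by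
      rw [hs]; infer_instance
    rw [Scheme.Hom.stalkMap_comp] at h2
    exact @IsIso.of_isIso_comp_right _ _ _ _ _ _ (s.stalkMap (genericPoint p.target)) _ h2
  rw [hgen] at h1
  have h3 : IsIso (X.presheaf.stalkSpecializes (specializes_of_eq (genericPoint_map f))) :=
    inferInstanceAs (IsIso (X.presheaf.stalkCongr (Inseparable.of_eq (genericPoint_map f).symm)).hom)
  exact ConcreteCategory.bijective_of_isIso (X.presheaf.stalkSpecializes
    (specializes_of_eq (genericPoint_map f)) ≫ f.stalkMap (genericPoint Y))

end Birational

instance (X : Scheme.{0}) [X.Over SpecC] [IsNormalVariety X] : X.IsSeparated :=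
  have := IsNormalVariety.isSeparated (X := X)
  ⟨by rw [← terminal.comp_from (X ↘ SpecC)]; infer_instance⟩

/-- Domination reflects units. This is how information from the valuation ring returns to the local
ring at `y₁`. -/
lemma LocalSubring.inv_mem_of_le {L : Type*} [Field L] {A R : LocalSubring L} (h : A ≤ R) {x : L}
    (hx0 : x ≠ 0) (hx : x ∈ A.toSubring) (hxR : x⁻¹ ∈ R.toSubring) : x⁻¹ ∈ A.toSubring := by
  obtain ⟨h1, h2⟩ := h
  have hu : IsUnit (Subring.inclusion h1 ⟨x, hx⟩) :=
    IsUnit.of_mul_eq_one ⟨x⁻¹, hxR⟩ (Subtype.ext (mul_inv_cancel₀ hx0))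
  obtain ⟨⟨u, hu⟩, e⟩ := isUnit_iff_exists_inv.mp (isUnit_of_map_unit _ _ hu)
  have e' : x * u = 1 := congr(($e).1)
  rwa [inv_eq_of_mul_eq_one_right e']

/-! ### Divisorial valuations seen in `K(X)`. -/

section FunctionField

variable {X Y : Scheme.{0}} [IsIntegral X] [IsIntegral Y]

/-- The inverse `K(Y) → K(X)` of the pullback of rational functions along a birational morphism. -/
noncomputable def pushforwardFunction (f : Y ⟶ X) [IsBirational f] :
    Y.functionField →+* X.functionField :=
  (RingEquiv.ofBijective (pullbackFunction f) (pullbackFunction_bijective f)).symm.toRingHom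

variable (f : Y ⟶ X) [IsBirational f]

lemma pushforwardFunction_pullbackFunction (φ : X.functionField) :
    pushforwardFunction f (pullbackFunction f φ) = φ :=
  (RingEquiv.ofBijective (pullbackFunction f) (pullbackFunction_bijective f)).symm_apply_apply φ

lemma pullbackFunction_pushforwardFunction (g : Y.functionField) :
    pullbackFunction f (pushforwardFunction f g) = g :=
  (RingEquiv.ofBijective (pullbackFunction f) (pullbackFunction_bijective f)).apply_symm_apply g

lemma pushforwardFunction_comp_pullbackFunction :
    (pushforwardFunction f).comp (pullbackFunction f) = RingHom.id _ :=
  RingHom.ext (pushforwardFunction_pullbackFunction f)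

lemma stalkSubring_id_le (y : Y) :
    stalkSubring (RingHom.id _) (f y) ≤ stalkSubring (pushforwardFunction f) y := by
  rw [← pushforwardFunction_comp_pullbackFunction f]
  exact stalkSubring_comp_pullbackFunction_le f _ y

lemma isRegularAt_pullbackFunction_iff {φ : X.functionField} {y : Y} :
    IsRegularAt (pullbackFunction f φ) y ↔
      φ ∈ (stalkSubring (pushforwardFunction f) y).toSubring := by
  rw [← mem_stalkSubring (i := pushforwardFunction f), pushforwardFunction_pullbackFunction]

omit [IsIntegral X] in
lemma ringKrullDim_stalkSubring {L : Type} [Field L] (i : Y.functionField →+* L)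
    (y : Y) : ringKrullDim (stalkSubring i y).toSubring = Order.coheight y := by
  rw [← ringKrullDim_stalk_eq_coheight]
  have hinj : Function.Injective
      (i.comp (algebraMap (Y.presheaf.stalk y) Y.functionField)) :=
    i.injective.comp (IsFractionRing.injective (Y.presheaf.stalk y) Y.functionField)
  exact ringKrullDim_eq_of_ringEquiv (RingEquiv.ofBijective
    (i.comp (algebraMap (Y.presheaf.stalk y) Y.functionField)).rangeRestrict
    ⟨fun a b h => hinj (congrArg Subtype.val h), RingHom.rangeRestrict_surjective _⟩).symm

variable [IsLocallyNoetherian Y] [IsNormalScheme Y]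

lemma comap_valuation_apply (F : PrimeDivisor Y)
    {φ : X.functionField} (hφ : φ ≠ 0) :
    F.valuation.comap (pullbackFunction f) φ =
      (Scheme.ord (pullbackFunction f φ) F.1 : WithTop ℤ) := by
  have h : pullbackFunction f φ ≠ 0 := by simpa using hφ
  exact if_neg h

lemma zero_le_comap_valuation_iff (F : PrimeDivisor Y) (φ : X.functionField) :
    0 ≤ F.valuation.comap (pullbackFunction f) φ ↔
      φ ∈ (stalkSubring (pushforwardFunction f) F.1).toSubring := by
  by_cases hφ : φ = 0
  · subst hφ
    simp [zero_mem]
  rw [comap_valuation_apply f F hφ, ← isRegularAt_pullbackFunction_iff,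
    ← F.ord_nonneg_iff (by simpa using hφ)]
  exact_mod_cast Iff.rfl

lemma stalkSubring_eq_of_valuation_eq {Y' : Scheme.{0}} [IsIntegral Y'] [IsLocallyNoetherian Y']
    [IsNormalScheme Y'] (f' : Y' ⟶ X) [IsBirational f'] {F : PrimeDivisor Y} {F' : PrimeDivisor Y'}
    (h : F.valuation.comap (pullbackFunction f) = F'.valuation.comap (pullbackFunction f')) :
    stalkSubring (pushforwardFunction f) F.1 = stalkSubring (pushforwardFunction f') F'.1 := by
  apply LocalSubring.toSubring_injective
  ext φ
  rw [← zero_le_comap_valuation_iff, ← zero_le_comap_valuation_iff, h]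

/-- The valuation determines the local ring, and on a separated scheme the local ring determines the
point. Hence no coefficients merge in `valuationCombination`. -/
lemma comap_valuation_injective [Y.IsSeparated] : Function.Injective
    fun F : PrimeDivisor Y => F.valuation.comap (pullbackFunction f) := fun _ _ h =>
  Subtype.ext (eq_of_stalkSubring_le le_rfl (stalkSubring_eq_of_valuation_eq f f h).ge)

lemma valuationCombination_apply [Y.IsSeparated] (E : QDivisor Y) (F : PrimeDivisor Y) :
    valuationCombination f E (F.valuation.comap (pullbackFunction f)) = E F :=
  Finsupp.mapDomain_apply (comap_valuation_injective f) E F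

lemma exists_of_valuationCombination_ne_zero {E : QDivisor Y}
    {v : AddValuation X.functionField (WithTop ℤ)} (h : valuationCombination f E v ≠ 0) :
    ∃ F : PrimeDivisor Y, F.valuation.comap (pullbackFunction f) = v := by
  by_contra hn
  exact h (Finsupp.mapDomain_of_notMem_range E v fun ⟨F, hF⟩ => hn ⟨F, hF⟩)

omit [IsLocallyNoetherian Y] [IsNormalScheme Y] in
/-- Over a point of codimension one of a normal scheme, a proper birational morphism has a prime
divisor with the same local ring. -/
lemma exists_primeDivisor_over [IsLocallyNoetherian X] [IsNormalScheme X] [UniversallyClosed f]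
    (G : PrimeDivisor X) : ∃ F : PrimeDivisor Y, f F.1 = G.1 ∧
      stalkSubring (pushforwardFunction f) F.1 = stalkSubring (RingHom.id _) G.1 := by
  have := isDiscreteValuationRing_stalk X G
  let R : ValuationSubring X.functionField :=
    ⟨(algebraMap (X.presheaf.stalk G.1) X.functionField).range,
      ValuationRing.isInteger_or_isInteger (X.presheaf.stalk G.1)⟩
  have hR : R.toLocalSubring = stalkSubring (RingHom.id _) G.1 :=
    LocalSubring.toSubring_injective rfl
  obtain ⟨y, hy, hyR⟩ := exists_stalkSubring_le f (pushforwardFunction f) G.1 R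
    (by rw [pushforwardFunction_comp_pullbackFunction, hR])
  -- The local ring at `y` dominates that at `G` and is dominated by `R`, which is that same ring.
  have heq : stalkSubring (pushforwardFunction f) y = stalkSubring (RingHom.id _) G.1 := by
    refine le_antisymm (hR ▸ hyR) ?_
    rw [← hy]
    exact stalkSubring_id_le f y
  refine ⟨⟨y, ?_⟩, hy, heq⟩
  have h1 := ringKrullDim_stalkSubring (pushforwardFunction f) y
  rw [heq, ringKrullDim_stalkSubring, G.2] at h1
  exact_mod_cast h1.symm

end FunctionField

/-! ### Sections of multiples of a divisor and their nonvanishing loci. -/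

section Sections

variable {Y : Scheme.{0}} [IsIntegral Y] [IsLocallyNoetherian Y] {D : QDivisor Y} {U : Y.Opens}
  {φ ψ : Y.functionField}

lemma IsCartier.exists_intCast_eq (h : IsCartier D) (F : PrimeDivisor Y) :
    ∃ z : ℤ, D F = z := by
  obtain ⟨U, hU, φ, -, hφ⟩ := h F.1
  exact ⟨_, hφ F hU⟩

lemma IsSection.pow (h : IsSection D U φ) (k : ℕ) : IsSection (k • D) U (φ ^ k) := by
  refine ⟨pow_ne_zero _ h.1, fun F hF => ?_⟩
  have := mul_nonneg (Nat.cast_nonneg (α := ℚ) k) (h.2 F hF)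
  rw [ord_pow h.1, Finsupp.smul_apply, nsmul_eq_mul]
  push_cast
  linarith

lemma nonvanishingLocus_pow (hφ : φ ≠ 0) {k : ℕ} (hk : 0 < k) :
    nonvanishingLocus (k • D) U (φ ^ k) = nonvanishingLocus D U φ := by
  have hk' : (k : ℚ) ≠ 0 := by positivity
  ext y
  refine and_congr_right fun _ => forall_congr' fun F => imp_congr_right fun _ => ?_
  rw [ord_pow hφ, Finsupp.smul_apply, nsmul_eq_mul]
  push_cast
  rw [← mul_add, mul_eq_zero]
  simp [hk']

/-- Unlike `nonvanishingLocus_pow`, this covers `k = 0`, which may occur as a bound on pole orders.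
-/
lemma mem_nonvanishingLocus_pow (hφ : φ ≠ 0) (k : ℕ) {y : Y} (hy : y ∈ nonvanishingLocus D U φ) :
    y ∈ nonvanishingLocus (k • D) U (φ ^ k) := by
  refine ⟨hy.1, fun F hF => ?_⟩
  have := hy.2 F hF
  rw [ord_pow hφ, Finsupp.smul_apply, nsmul_eq_mul]
  push_cast
  rw [← mul_add, this, mul_zero]

variable [IsNormalScheme Y]

/-- A quotient of sections is regular where the denominator does not vanish. -/
lemma IsSection.isRegularAt_div (hψ : IsSection D U ψ) (hφ : φ ≠ 0) {y : Y}
    (hy : y ∈ nonvanishingLocus D U φ) : IsRegularAt (ψ / φ) y := by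
  refine isRegularAt_of_forall_primeDivisor fun F hF => ?_
  rw [← F.ord_nonneg_iff (div_ne_zero hψ.1 hφ), ord_div hψ.1 hφ]
  have h1 := hψ.2 F (hF.mem_open U.2 hy.1)
  have h2 := hy.2 F hF
  have : (0 : ℚ) ≤ ((Scheme.ord ψ F.1 - Scheme.ord φ F.1 : ℤ) : ℚ) := by
    push_cast; linarith
  exact_mod_cast this

/-- Near `y`, regularity of the quotient gives `div ψ ≤ div φ = -D`, and the section condition gives
the reverse inequality. -/
lemma IsSection.mem_nonvanishingLocus (hψ : IsSection D U ψ) (hφ : φ ≠ 0) {y : Y}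
    (hy : y ∈ nonvanishingLocus D U φ) (hreg : IsRegularAt (φ / ψ) y) :
    y ∈ nonvanishingLocus D U ψ := by
  refine ⟨hy.1, fun F hF => ?_⟩
  have h1 := hψ.2 F (hF.mem_open U.2 hy.1)
  have h2 := hy.2 F hF
  have h3 := (F.ord_nonneg_iff (div_ne_zero hφ hψ.1)).mpr (hreg.of_specializes hF)
  rw [ord_div hφ hψ.1] at h3
  have : (0 : ℚ) ≤ ((Scheme.ord φ F.1 - Scheme.ord ψ F.1 : ℤ) : ℚ) := by exact_mod_cast h3
  push_cast at this
  linarith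

omit [IsIntegral Y] [IsLocallyNoetherian Y] [IsNormalScheme Y] in
lemma PrimeDivisor.eq_of_specializes {F G : PrimeDivisor Y} (h : F.1 ⤳ G.1) : F = G := by
  by_contra hne
  have hlt : G.1 < F.1 :=
    lt_of_le_not_ge h fun h' => hne (Subtype.ext (Specializes.antisymm h h').eq)
  have := Order.coheight_strictAnti hlt (by rw [F.2]; exact ENat.one_lt_top)
  rw [F.2, G.2] at this
  exact lt_irrefl _ this

/-- A rational function which is regular on the nonvanishing locus of a section of an integral
divisor becomes a section after multiplication with a power of that section. -/
lemma exists_isSection_mul_pow (hU : IsCompact (U : Set Y)) (hD : ∀ F, ∃ z : ℤ, D F = z)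
    (hφ : IsSection D U φ) {g : Y.functionField} (hg : g ≠ 0)
    (hreg : ∀ F : PrimeDivisor Y, F.1 ∈ nonvanishingLocus D U φ → IsRegularAt g F.1) :
    ∃ k : ℕ, IsSection (k • D) U (g * φ ^ k) := by
  obtain ⟨k, hk⟩ := exists_forall_neg_le_ord hU hg
  refine ⟨k, mul_ne_zero hg (pow_ne_zero _ hφ.1), fun F hF => ?_⟩
  have h1 := hφ.2 F hF
  rw [Scheme.ord_mul hg (pow_ne_zero _ hφ.1), ord_pow hφ.1, Finsupp.smul_apply, nsmul_eq_mul]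
  push_cast
  by_cases hF' : F.1 ∈ nonvanishingLocus D U φ
  · have h2 : (0 : ℚ) ≤ Scheme.ord g F.1 := by
      exact_mod_cast (F.ord_nonneg_iff hg).mpr (hreg F hF')
    have := mul_nonneg (Nat.cast_nonneg (α := ℚ) k) h1
    linarith
  -- Off the locus, integrality raises the positive coefficient of `div φ + D` to at least `1`, so
  -- `k` copies absorb a pole of order at most `k`.
  · have h2 : (Scheme.ord φ F.1 : ℚ) + D F ≠ 0 := fun h0 =>
      hF' ⟨hF, fun G hG => by rw [PrimeDivisor.eq_of_specializes hG]; exact h0⟩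
    obtain ⟨z, hz⟩ := hD F
    have h3 : (1 : ℚ) ≤ Scheme.ord φ F.1 + D F := by
      rw [hz] at h1 h2 ⊢
      have h1' : 0 ≤ Scheme.ord φ F.1 + z := by exact_mod_cast h1
      have h2' : Scheme.ord φ F.1 + z ≠ 0 := by exact_mod_cast h2
      have : 1 ≤ Scheme.ord φ F.1 + z := by omega
      exact_mod_cast this
    have h4 : (-(k : ℚ)) ≤ Scheme.ord g F.1 := by exact_mod_cast hk F hF
    have := mul_le_mul_of_nonneg_left h3 (Nat.cast_nonneg (α := ℚ) k)
    linarith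

end Sections

/-! ### Comparison of sections and of local rings on the two models. -/

section Comparison

variable {X Y₁ Y₂ : Scheme.{0}} [IsIntegral X] [IsIntegral Y₁] [IsIntegral Y₂]
  [IsLocallyNoetherian X] [IsLocallyNoetherian Y₁] [IsLocallyNoetherian Y₂]
  [IsNormalScheme X] [IsNormalScheme Y₁] [IsNormalScheme Y₂]
  [X.IsSeparated] [Y₁.IsSeparated] [Y₂.IsSeparated]
  (f₁ : Y₁ ⟶ X) (f₂ : Y₂ ⟶ X) [IsBirational f₁] [IsBirational f₂]
  [UniversallyClosed f₁] [UniversallyClosed f₂]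
  {E₁ : QDivisor Y₁} {E₂ : QDivisor Y₂}

omit [UniversallyClosed f₂] in
/-- The sections of `𝒪(-N E)` over the inverse image of an open subset of `X` depend only on the
combination of valuations defined by the exceptional divisor `E`. -/
lemma IsSection.of_valuationCombination_eq (hexc₁ : IsExceptional f₁ E₁)
    (hval : valuationCombination f₁ E₁ = valuationCombination f₂ E₂) {N : ℕ} {V : X.Opens}
    {φ : X.functionField} (h : IsSection (N • -E₁) (f₁ ⁻¹ᵁ V) (pullbackFunction f₁ φ)) :
    IsSection (N • -E₂) (f₂ ⁻¹ᵁ V) (pullbackFunction f₂ φ) := by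
  have hφ : φ ≠ 0 := by simpa using h.1
  refine ⟨by simpa using hφ, fun F₂ hF₂ => ?_⟩
  by_cases hE : E₂ F₂ = 0
  · have hreg : IsRegularAt φ (f₂ F₂.1) := by
      refine isRegularAt_of_forall_primeDivisor fun G hG => ?_
      -- The divisor over `G` has image of codimension one, so it cannot occur in the exceptional
      -- divisor `E₁`.
      obtain ⟨F₁, hF₁, heq⟩ := exists_primeDivisor_over f₁ G
      have hE₁ : E₁ F₁ = 0 := by
        by_contra hne
        have := hexc₁ F₁ (Finsupp.mem_support_iff.mpr hne)
        rw [hF₁, G.2] at this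
        exact absurd this (by decide)
      have hGV : f₁ F₁.1 ∈ V := by
        rw [hF₁]
        exact hG.mem_open V.2 hF₂
      have h1 := h.2 F₁ hGV
      simp only [Finsupp.smul_apply, Finsupp.neg_apply, hE₁, neg_zero, smul_zero, add_zero] at h1
      have h2 : 0 ≤ Scheme.ord (pullbackFunction f₁ φ) F₁.1 := by exact_mod_cast h1
      rw [F₁.ord_nonneg_iff h.1, isRegularAt_pullbackFunction_iff, heq] at h2
      exact mem_stalkSubring.mp h2
    have h2 : IsRegularAt (pullbackFunction f₂ φ) F₂.1 := by
      rw [isRegularAt_pullbackFunction_iff]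
      exact (stalkSubring_id_le f₂ F₂.1).1 (mem_stalkSubring.mpr hreg)
    rw [← F₂.ord_nonneg_iff (by simpa using hφ)] at h2
    simp only [Finsupp.smul_apply, Finsupp.neg_apply, hE, neg_zero, smul_zero, add_zero]
    exact_mod_cast h2
  · rw [← valuationCombination_apply f₂, ← hval] at hE
    obtain ⟨F₁, hF₁⟩ := exists_of_valuationCombination_ne_zero f₁ hE
    have hcoeff : E₁ F₁ = E₂ F₂ := by
      rw [← valuationCombination_apply f₁, ← valuationCombination_apply f₂, hval, hF₁]
    -- The common local ring of `F₁` and `F₂` dominates the local rings of `X` at both images, and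
    -- `X` is separated.
    have hcenter : f₁ F₁.1 = f₂ F₂.1 := eq_of_stalkSubring_le
      (i := RingHom.id X.functionField) (stalkSubring_id_le f₁ F₁.1)
      (by rw [stalkSubring_eq_of_valuation_eq f₁ f₂ hF₁]; exact stalkSubring_id_le f₂ F₂.1)
    have hV : f₁ F₁.1 ∈ V := hcenter ▸ hF₂
    have hord : Scheme.ord (pullbackFunction f₁ φ) F₁.1 =
        Scheme.ord (pullbackFunction f₂ φ) F₂.1 := by
      have := congr($hF₁ φ)
      rw [comap_valuation_apply f₁ F₁ hφ, comap_valuation_apply f₂ F₂ hφ] at this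
      exact_mod_cast this
    have h1 := h.2 F₁ hV
    rw [hord] at h1
    simpa only [Finsupp.smul_apply, Finsupp.neg_apply, hcoeff] using h1

/-- Every local ring of `Y₁` contains a local ring of `Y₂`. -/
lemma exists_stalkSubring_le_stalkSubring
    (hexc₁ : IsExceptional f₁ E₁) (hexc₂ : IsExceptional f₂ E₂)
    (hample₁ : IsRelativelyAmple f₁ (-E₁)) (hample₂ : IsRelativelyAmple f₂ (-E₂))
    (hval : valuationCombination f₁ E₁ = valuationCombination f₂ E₂) (y₁ : Y₁) :
    ∃ y₂ : Y₂, (stalkSubring (pushforwardFunction f₂) y₂).toSubring ≤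
      (stalkSubring (pushforwardFunction f₁) y₁).toSubring := by
  obtain ⟨R, hR⟩ := (stalkSubring (pushforwardFunction f₁) y₁).exists_le_valuationSubring
  obtain ⟨y₂, hy₂, hy₂R⟩ := exists_stalkSubring_le f₂ (pushforwardFunction f₂) (f₁ y₁) R (by
    rw [pushforwardFunction_comp_pullbackFunction]
    exact (stalkSubring_id_le f₁ y₁).trans hR)
  refine ⟨y₂, ?_⟩
  obtain ⟨_, ⟨V, hV, rfl⟩, hxV, -⟩ :=
    X.isBasis_affineOpens.exists_subset_of_mem_open (Set.mem_univ (f₁ y₁)) isOpen_univ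
  obtain ⟨m₁, hm₁, -, ha₁⟩ := hample₁
  obtain ⟨m₂, hm₂, hc₂, ha₂⟩ := hample₂
  obtain ⟨n₁, hn₁, φ₁, hφ₁, W₁, -, hyW₁, hW₁⟩ := (ha₁ V hV).2 y₁ hxV
  obtain ⟨hU₂, ha₂⟩ := ha₂ V hV
  obtain ⟨n₂, hn₂, φ₂, hφ₂, W₂, hW₂aff, hyW₂, hW₂⟩ := ha₂ y₂ (show f₂ y₂ ∈ V from hy₂ ▸ hxV)
  -- Ampleness yields different multiples on the two sides; `N = n₁ m₁ n₂ m₂` is common to both, and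
  -- powers of `φ₁` and `φ₂` are sections for it.
  obtain ⟨N, hN₁, hN₂⟩ : ∃ N : ℕ, N • -E₁ = (n₂ * m₂) • n₁ • m₁ • -E₁ ∧
      N • -E₂ = (n₁ * m₁) • n₂ • m₂ • -E₂ :=
    ⟨n₁ * m₁ * (n₂ * m₂), by simp only [smul_smul]; congr 1; ring,
      by simp only [smul_smul, mul_assoc]⟩
  have hint : ∀ F, ∃ z : ℤ, (N • -E₂) F = z := fun F => by
    obtain ⟨z, hz⟩ := hc₂.exists_intCast_eq F
    refine ⟨(n₁ * m₁ * n₂ : ℕ) * z, ?_⟩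
    rw [hN₂, smul_smul, Finsupp.smul_apply, hz, nsmul_eq_mul]
    push_cast; ring
  obtain ⟨α₁, hα₁⟩ : ∃ α, pullbackFunction f₁ α = φ₁ ^ (n₂ * m₂) :=
    ⟨_, pullbackFunction_pushforwardFunction f₁ _⟩
  obtain ⟨α₂, hα₂⟩ : ∃ α, pullbackFunction f₂ α = φ₂ ^ (n₁ * m₁) :=
    ⟨_, pullbackFunction_pushforwardFunction f₂ _⟩
  have hs₁₁ : IsSection (N • -E₁) (f₁ ⁻¹ᵁ V) (pullbackFunction f₁ α₁) := by
    rw [hα₁, hN₁]; exact hφ₁.pow _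
  have hs₂₂ : IsSection (N • -E₂) (f₂ ⁻¹ᵁ V) (pullbackFunction f₂ α₂) := by
    rw [hα₂, hN₂]; exact hφ₂.pow _
  have hs₂₁ := hs₁₁.of_valuationCombination_eq f₁ f₂ hexc₁ hval
  have hs₁₂ := hs₂₂.of_valuationCombination_eq f₂ f₁ hexc₂ hval.symm
  have hα₁0 : α₁ ≠ 0 := by simpa using hs₁₁.1
  have hα₂0 : α₂ ≠ 0 := by simpa using hs₂₂.1
  have hloc₁ : y₁ ∈ nonvanishingLocus (N • -E₁) (f₁ ⁻¹ᵁ V) (pullbackFunction f₁ α₁) := by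
    rw [hα₁, hN₁, nonvanishingLocus_pow hφ₁.1 (Nat.mul_pos hn₂ hm₂), ← hW₁]; exact hyW₁
  have hloc₂ : (W₂ : Set Y₂) =
      nonvanishingLocus (N • -E₂) (f₂ ⁻¹ᵁ V) (pullbackFunction f₂ α₂) := by
    rw [hα₂, hN₂, nonvanishingLocus_pow hφ₂.1 (Nat.mul_pos hn₁ hm₁), hW₂]
  have hq₁ : α₂ / α₁ ∈ (stalkSubring (pushforwardFunction f₁) y₁).toSubring := by
    rw [← isRegularAt_pullbackFunction_iff, map_div₀]
    exact hs₁₂.isRegularAt_div hs₁₁.1 hloc₁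
  have hq₂ : α₁ / α₂ ∈ (stalkSubring (pushforwardFunction f₂) y₂).toSubring := by
    rw [← isRegularAt_pullbackFunction_iff, map_div₀]
    exact hs₂₁.isRegularAt_div hs₂₂.1 (hloc₂ ▸ hyW₂)
  -- `R` contains both `α₁ / α₂` and its inverse and dominates the local ring at `y₁`, so the
  -- quotient is a unit there.
  have hq₁' : α₁ / α₂ ∈ (stalkSubring (pushforwardFunction f₁) y₁).toSubring := by
    rw [← inv_div]
    exact LocalSubring.inv_mem_of_le hR (div_ne_zero hα₂0 hα₁0) hq₁
      (by rw [inv_div]; exact hy₂R.1 hq₂)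
  have hloc₁₂ : y₁ ∈ nonvanishingLocus (N • -E₁) (f₁ ⁻¹ᵁ V) (pullbackFunction f₁ α₂) :=
    hs₁₂.mem_nonvanishingLocus hs₁₁.1 hloc₁
      (by rw [← map_div₀, isRegularAt_pullbackFunction_iff]; exact hq₁')
  have : Nonempty W₂ := ⟨⟨y₂, hyW₂⟩⟩
  have key : ∀ a : Γ(Y₂, W₂), pushforwardFunction f₂ (Y₂.germToFunctionField W₂ a) ∈
      (stalkSubring (pushforwardFunction f₁) y₁).toSubring := by
    intro a
    by_cases ha : Y₂.germToFunctionField W₂ a = 0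
    · rw [ha, map_zero]; exact zero_mem _
    -- A power of `α₂` clears the poles of `a` outside `W₂`. The product is also a section on `Y₁`,
    -- where dividing by that power preserves regularity at `y₁`.
    obtain ⟨k, hk⟩ := exists_isSection_mul_pow hU₂ hint hs₂₂ ha fun F hF => by
      rw [← hloc₂] at hF
      exact ⟨_, Scheme.algebraMap_germ_eq_germToFunctionField Y₂ hF a⟩
    set g := pushforwardFunction f₂ (Y₂.germToFunctionField W₂ a) with hg
    rw [← pullbackFunction_pushforwardFunction f₂ (Y₂.germToFunctionField W₂ a), ← hg, ← map_pow,
      ← map_mul, smul_smul] at hk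
    have hk' := hk.of_valuationCombination_eq f₂ f₁ hexc₂ hval.symm
    rw [← smul_smul] at hk'
    have hreg := hk'.isRegularAt_div (pow_ne_zero k hs₁₂.1)
      (mem_nonvanishingLocus_pow hs₁₂.1 k hloc₁₂)
    rwa [← map_pow, ← map_div₀, mul_div_cancel_right₀ _ (pow_ne_zero k hα₂0),
      isRegularAt_pullbackFunction_iff] at hreg
  rintro _ ⟨b, rfl⟩
  obtain ⟨a, s, hs, has⟩ := (isRegularAt_iff_of_isAffineOpen hW₂aff ⟨y₂, hyW₂⟩ _).mp
    (⟨b, rfl⟩ : IsRegularAt (algebraMap _ Y₂.functionField b) y₂)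
  have hs0 : Y₂.germToFunctionField W₂ s ≠ 0 := fun h0 => hs (by
    have : s = 0 := Scheme.germToFunctionField_injective Y₂ W₂ (by rw [h0, map_zero])
    rw [this]; exact zero_mem _)
  have hsinv : IsRegularAt (Y₂.germToFunctionField W₂ s)⁻¹ y₂ :=
    (isRegularAt_iff_of_isAffineOpen hW₂aff ⟨y₂, hyW₂⟩ _).mpr
      ⟨1, s, hs, by rw [inv_mul_cancel₀ hs0, map_one]⟩
  rw [← mem_stalkSubring (i := pushforwardFunction f₂), map_inv₀] at hsinv
  -- The denominator `s` is invertible at `y₂`, hence in `R`, hence at `y₁`.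
  have h1 := LocalSubring.inv_mem_of_le hR (by simpa using hs0) (key s) (hy₂R.1 hsinv)
  have h2 := mul_mem (key a) h1
  rw [← has, ← map_inv₀, ← map_mul, mul_assoc, mul_inv_cancel₀ hs0, mul_one] at h2
  exact h2

end Comparison

/-! ### From inclusions of local rings to mutually inverse morphisms. -/

section Extension

instance {Y : Scheme.{0}} [IsIntegral Y] : IsDominant (Y.fromSpecStalk (genericPoint Y)) := by
  refine ⟨Dense.mono (s₁ := {genericPoint Y}) ?_ ?_⟩
  · rw [Scheme.range_fromSpecStalk]
    exact Set.singleton_subset_iff.mpr (specializes_refl _)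
  · exact dense_iff_closure_eq.mpr (genericPoint_spec Y)

variable {X Y₁ Y₂ : Scheme.{0}} [IsIntegral X] [IsIntegral Y₁] [IsIntegral Y₂]
  [X.IsSeparated] [Y₂.IsSeparated]
  (f₁ : Y₁ ⟶ X) (f₂ : Y₂ ⟶ X) [IsBirational f₁] [IsBirational f₂] [LocallyOfFiniteType f₂]

/-- Each inclusion gives a map `θ` of stalks compatible with the function fields. `Spec` of `θ`,
followed by the canonical map to `Y₂`, extends the generic morphism to the local scheme at `y₁`; `θ`
need not be local. -/
lemma exists_hom_of_forall_stalkSubring_le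
    (h : ∀ y₁ : Y₁, ∃ y₂ : Y₂, (stalkSubring (pushforwardFunction f₂) y₂).toSubring ≤
      (stalkSubring (pushforwardFunction f₁) y₁).toSubring) :
    ∃ e : Y₁ ⟶ Y₂, e ≫ f₂ = f₁ ∧ Y₁.fromSpecStalk (genericPoint Y₁) ≫ e =
      fromSpecField ((pullbackFunction f₁).comp (pushforwardFunction f₂)) := by
  have hj : fromSpecField ((pullbackFunction f₁).comp (pushforwardFunction f₂)) ≫ f₂ =
      Y₁.fromSpecStalk (genericPoint Y₁) ≫ f₁ := by
    rw [fromSpecField_comp, RingHom.comp_assoc, pushforwardFunction_comp_pullbackFunction,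
      RingHom.comp_id, ← RingHom.id_comp (pullbackFunction f₁), ← fromSpecField_comp, fromSpecField]
    simp
  obtain ⟨e, he⟩ := exists_hom_of_forall_stalk f₁ f₂ _ hj fun y₁ => by
    obtain ⟨y₂, hy⟩ := h y₁
    let a₁ := algebraMap (Y₁.presheaf.stalk y₁) Y₁.functionField
    let a₂ := algebraMap (Y₂.presheaf.stalk y₂) Y₂.functionField
    have ha₁ : Function.Injective a₁ := IsFractionRing.injective _ _
    have hmem : ∀ b, (pullbackFunction f₁) (pushforwardFunction f₂ (a₂ b)) ∈ a₁.range := fun b =>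
      (isRegularAt_pullbackFunction_iff f₁).mpr (hy ⟨b, rfl⟩)
    let θ : Y₂.presheaf.stalk y₂ →+* Y₁.presheaf.stalk y₁ :=
      (RingEquiv.ofBijective a₁.rangeRestrict
        ⟨fun _ _ h => ha₁ (congrArg Subtype.val h), a₁.rangeRestrict_surjective⟩).symm.toRingHom.comp
        ((((pullbackFunction f₁).comp (pushforwardFunction f₂)).comp a₂).codRestrict a₁.range hmem)
    have hθ : a₁.comp θ = ((pullbackFunction f₁).comp (pushforwardFunction f₂)).comp a₂ := by
      ext b
      exact congrArg Subtype.val ((RingEquiv.ofBijective a₁.rangeRestrict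
        ⟨fun _ _ h => ha₁ (congrArg Subtype.val h), a₁.rangeRestrict_surjective⟩).apply_symm_apply
          ⟨_, hmem b⟩)
    refine ⟨Spec.map (CommRingCat.ofHom θ) ≫ Y₂.fromSpecStalk y₂, ?_⟩
    rw [fromSpecField_eq _ y₂, ← hθ, CommRingCat.ofHom_comp, Spec.map_comp, Category.assoc]
    rfl
  refine ⟨e, ext_of_isDominant (Y₁.fromSpecStalk (genericPoint Y₁)) ?_, he⟩
  rw [← Category.assoc, he, hj]

omit [X.IsSeparated] [Y₂.IsSeparated] [LocallyOfFiniteType f₂] in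
-- Both sides agree on the generic point, which is dense in the reduced scheme `Y₁`, and the target
-- is separated.
lemma hom_comp_hom_eq_id [Y₁.IsSeparated] {e : Y₁ ⟶ Y₂} {e' : Y₂ ⟶ Y₁}
    (he : Y₁.fromSpecStalk (genericPoint Y₁) ≫ e =
      fromSpecField ((pullbackFunction f₁).comp (pushforwardFunction f₂)))
    (he' : Y₂.fromSpecStalk (genericPoint Y₂) ≫ e' =
      fromSpecField ((pullbackFunction f₂).comp (pushforwardFunction f₁))) : e ≫ e' = 𝟙 Y₁ := by
  refine ext_of_isDominant (Y₁.fromSpecStalk (genericPoint Y₁)) ?_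
  have hid : (((pullbackFunction f₁).comp (pushforwardFunction f₂)).comp
      ((pullbackFunction f₂).comp (pushforwardFunction f₁))) = RingHom.id _ := by
    ext g
    simp [pushforwardFunction_pullbackFunction, pullbackFunction_pushforwardFunction]
  rw [← Category.assoc, he, fromSpecField, Category.assoc, he', fromSpecField, ← Category.assoc,
    ← Spec.map_comp]
  erw [← CommRingCat.ofHom_comp]
  rw [hid, CommRingCat.ofHom_id, Spec.map_id, Category.comp_id]
  exact Category.id_comp _

end Extension

end BirationalGeometry

open BirationalGeometry
theorem mainTheorem7 (X Y₁ Y₂ : Scheme.{0})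
    [X.Over SpecC] [Y₁.Over SpecC] [Y₂.Over SpecC]
    [IsNormalVariety X] [IsNormalVariety Y₁] [IsNormalVariety Y₂]
    (f₁ : Y₁ ⟶ X) (f₂ : Y₂ ⟶ X) [f₁.IsOver SpecC] [f₂.IsOver SpecC]
    [IsProjective f₁] [IsProjective f₂] [IsBirational f₁] [IsBirational f₂]
    (E₁ : QDivisor Y₁) (E₂ : QDivisor Y₂)
    (hexc₁ : IsExceptional f₁ E₁) (hexc₂ : IsExceptional f₂ E₂)
    (hcar₁ : IsQCartier E₁) (hcar₂ : IsQCartier E₂)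
    (hample₁ : IsRelativelyAmple f₁ (-E₁)) (hample₂ : IsRelativelyAmple f₂ (-E₂))
    (hval : valuationCombination f₁ E₁ = valuationCombination f₂ E₂) :
    ∃ e : Y₁ ≅ Y₂, e.hom ≫ f₂ = f₁ := by
  have := IsProjective.universallyClosed f₁
  have := IsProjective.universallyClosed f₂
  have h₁ : LocallyOfFiniteType (f₁ ≫ (X ↘ SpecC)) := by
    rw [comp_over]; exact IsNormalVariety.locallyOfFiniteType
  have h₂ : LocallyOfFiniteType (f₂ ≫ (X ↘ SpecC)) := by
    rw [comp_over]; exact IsNormalVariety.locallyOfFiniteType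
  have := locallyOfFiniteType_of_comp f₁ (X ↘ SpecC)
  have := locallyOfFiniteType_of_comp f₂ (X ↘ SpecC)
  obtain ⟨e, hef, he⟩ := exists_hom_of_forall_stalkSubring_le f₁ f₂
    (exists_stalkSubring_le_stalkSubring f₁ f₂ hexc₁ hexc₂ hample₁ hample₂ hval)
  obtain ⟨e', -, he'⟩ := exists_hom_of_forall_stalkSubring_le f₂ f₁
    (exists_stalkSubring_le_stalkSubring f₂ f₁ hexc₂ hexc₁ hample₂ hample₁ hval.symm)
  exact ⟨⟨e, e', hom_comp_hom_eq_id f₁ f₂ he he', hom_comp_hom_eq_id f₂ f₁ he' he⟩, hef⟩
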